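/- **Definitions.** For real $a,b,p,q,r$ write $(a,b,p,q,r)\in P$ if $r\notin\{0,-1,-2,\dots\}$, ${}_2F_1(p,q;r;x)>0$ for all $x\in(0,1)$, and $a>0$, $b>0$, $r+b-p-q>0$. In this case the beta hypergeometric distribution is $$BH(a,b,p,q,r)(dx)=\frac{x^{a-1}(1-x)^{b-1}\,{}_2F_1(p,q;r;x)}{B(a,b)\,{}_3F_2(a,p,q;r,a+b;1)}\,\mathbf 1_{(0,1)}(x)\,dx .$$ For $\theta=(\theta_1,\dots,\theta_5)\in\mathbb R^5$ put $a=\theta_4+\theta_5$, $b=\theta_1+\theta_3$, $p=\theta_3+\theta_5$, $q=\theta_3+\theta_4$, $r=\theta_2+\theta_3+\theta_4+\theta_5$; say that $BH_\theta$ exists if $(a,b,p,q,r)\in P$, and then put $BH_\theta=BH(a,b,p,q,r)$. The existence and the value of $BH_\theta$ depend only on the triple $v_\theta=(\theta_1,\{\theta_2,\theta_3\},\{\theta_4,\theta_5\})$, where $\{\cdot,\cdot\}$ denotes an unordered pair of possibly equal entries; for $v=v_\theta$ write $BH_v=BH_\theta$. For $c,d>0$ let $$\beta^{(2)}_{c,d}(dw)=\frac{1}{B(c,d)}\frac{w^{c-1}}{(1+w)^{c+d}}\mathbf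 1_{(0,\infty)}(w)\,dw .$$ Fix $\theta\in\mathbb R^5$. The directed graph $G_\theta$ has as vertices all triples $v_{\theta'}$ with $\theta'$ obtained from $\theta$ by permuting its entries, and from each vertex $v=(t_1,\{t_2,t_3\},\{t_4,t_5\})$ it has edges to $(t_5,\{t_1,t_4\},\{t_2,t_3\})$ and to $(t_4,\{t_1,t_5\},\{t_2,t_3\})$ (these may coincide). To these edges attach the pairs $(c,d)=(t_1+t_5,\,t_2+t_3)$ and $(c,d)=(t_1+t_4,\,t_2+t_3)$ respectively. The graph $G^{*}_\theta$ is obtained from $G_\theta$ by keeping only the edges with $c>0$ and $d>0$; for such an edge $(v,v')$ put $\beta^{(v,v')}=\beta^{(2)}_{c,d}$. The graph $G^{**}_\theta$ is obtained from $G^{*}_\theta$ by removing the vertices $v$ for which $BH_v$ does not exist, together with all edges adjacent to them. For $w>0$ let $H_w(x)=\dfrac1{1+wx}$. **Proposition 4.1.** Let $n\ge 0$ and let $v_0\to v_1\to\cdots\to v_n$ be a path of not necessarily distinct vertices in $G^{**}_\theta$. Let $X_0,W_1,\dots,W_n$ be independent random variables with $X_0\sim BH_{v_0}$ and $W_j\sim\beta^{(v_{j-1},v_j)}$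 for $j=1,\dots,n$. Then $$H_{W_n}\circ H_{W_{n-1}}\circ\cdots\circ H_{W_1}(X_0)=\cfrac{1}{1+\cfrac{W_n}{\ddots+\cfrac{W_2}{1+W_1X_0}}}\ \sim\ BH_{v_n}.$$ -/

import Mathlib

open MeasureTheory ProbabilityTheory Set

namespace BetaHypergeometric

noncomputable section

/-! ### Hypergeometric functions and the distributions -/

/-- The generalized hypergeometric series
`₃F₂(A, B, C; D, E; x) = ∑ (A)ₙ (B)ₙ (C)ₙ / (n! (D)ₙ (E)ₙ) xⁿ`. -/
def hypergeometric32 (A B C D E x : ℝ) : ℝ :=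
  ∑' n : ℕ, ((ascPochhammer ℝ n).eval A * (ascPochhammer ℝ n).eval B *
    (ascPochhammer ℝ n).eval C) /
      ((n.factorial : ℝ) * (ascPochhammer ℝ n).eval D * (ascPochhammer ℝ n).eval E) * x ^ n

/-- The set `P` of parameters `(a, b, p, q, r)` for which the beta hypergeometric distribution
is defined: `r ∉ {0, -1, -2, …}`, `₂F₁(p, q; r; x) > 0` for all `x ∈ (0, 1)`, and
`a`, `b`, `r + b - p - q` are positive. -/
structure BHParam (a b p q r : ℝ) : Prop where
  not_pole : ∀ n : ℕ, r ≠ -(n : ℝ)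
  hypergeometric_pos : ∀ x ∈ Ioo (0 : ℝ) 1, 0 < ₂F₁ p q r x
  a_pos : 0 < a
  b_pos : 0 < b
  s_pos : 0 < r + b - p - q

/-- The beta hypergeometric distribution `BH(a, b, p, q, r)` (meaningful when
`BHParam a b p q r` holds). -/
def bh (a b p q r : ℝ) : Measure ℝ :=
  (volume.restrict (Ioo 0 1)).withDensity fun x =>
    ENNReal.ofReal (x ^ (a - 1) * (1 - x) ^ (b - 1) * ₂F₁ p q r x /
      (ProbabilityTheory.beta a b * hypergeometric32 a p q r (a + b) 1))

/-- The beta distribution of the second kind with parameters `c, d` (meaningful for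
`c, d > 0`). -/
def betaSecondKind (c d : ℝ) : Measure ℝ :=
  (volume.restrict (Ioi 0)).withDensity fun w =>
    ENNReal.ofReal (1 / ProbabilityTheory.beta c d * (w ^ (c - 1) / (1 + w) ^ (c + d)))

/-! ### The parameterization by `θ`

A vector `θ : Fin 5 → ℝ` lists `(θ₁, θ₂, θ₃, θ₄, θ₅)` as `(θ 0, θ 1, θ 2, θ 3, θ 4)`. -/

/-- `BH_θ` exists: the parameters `a = θ₄ + θ₅`, `b = θ₁ + θ₃`, `p = θ₃ + θ₅`, `q = θ₃ + θ₄`,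
`r = θ₂ + θ₃ + θ₄ + θ₅` are in `P`. -/
def BHThetaExists (θ : Fin 5 → ℝ) : Prop :=
  BHParam (θ 3 + θ 4) (θ 0 + θ 2) (θ 2 + θ 4) (θ 2 + θ 3) (θ 1 + θ 2 + θ 3 + θ 4)

/-- The distribution `BH_θ`. -/
def bhTheta (θ : Fin 5 → ℝ) : Measure ℝ :=
  bh (θ 3 + θ 4) (θ 0 + θ 2) (θ 2 + θ 4) (θ 2 + θ 3) (θ 1 + θ 2 + θ 3 + θ 4)

/-! ### The graphs -/

/-- Triples `(t, {s, s'}, {u, u'})` of a real number and two unordered pairs of (possibly equal)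
real numbers. -/
abbrev Triple : Type := ℝ × Sym2 ℝ × Sym2 ℝ

/-- `v_θ = (θ₁, {θ₂, θ₃}, {θ₄, θ₅})`. -/
def triple (θ : Fin 5 → ℝ) : Triple := (θ 0, s(θ 1, θ 2), s(θ 3, θ 4))

/-- The vertices of the graph `G_θ`: all the triples got by permuting the entries of `θ`. -/
abbrev Vertex (θ : Fin 5 → ℝ) : Type :=
  {v : Triple // ∃ σ : Equiv.Perm (Fin 5), v = triple (θ ∘ σ)}

/-- The directed graph `G_θ`: from `(t₁, {t₂, t₃}, {t₄, t₅})` there are edges to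
`(t₅, {t₁, t₄}, {t₂, t₃})` and to `(t₄, {t₁, t₅}, {t₂, t₃})`. -/
def graph (θ : Fin 5 → ℝ) : Digraph (Vertex θ) where
  Adj v v' := ∃ t : Fin 5 → ℝ, v.1 = triple t ∧
    (v'.1 = (t 4, s(t 0, t 3), s(t 1, t 2)) ∨ v'.1 = (t 3, s(t 0, t 4), s(t 1, t 2)))

/-- The sum of the two entries of an unordered pair. -/
def pairSum : Sym2 ℝ → ℝ := Sym2.lift ⟨fun x y => x + y, fun x y => add_comm x y⟩

/-- The first parameter of the beta distribution attached to an edge `(v, v')`: the sum of the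
first entries of `v` and `v'`, that is, `t₁ + t₅` for the edge from `(t₁, {t₂, t₃}, {t₄, t₅})` to
`(t₅, {t₁, t₄}, {t₂, t₃})` and `t₁ + t₄` for the edge to `(t₄, {t₁, t₅}, {t₂, t₃})`. -/
def edgeFst (v v' : Triple) : ℝ := v.1 + v'.1

/-- The second parameter of the beta distribution attached to an edge `(v, v')`: it is `t₂ + t₃`
for both edges from `v = (t₁, {t₂, t₃}, {t₄, t₅})`. -/
def edgeSnd (v _v' : Triple) : ℝ := pairSum v.2.1

/-- The graph `G*_θ`: the acceptable edges of `G_θ`, for which the beta distribution attached to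
the edge has positive parameters. -/
def graphStar (θ : Fin 5 → ℝ) : Digraph (Vertex θ) where
  Adj v v' := (graph θ).Adj v v' ∧ 0 < edgeSnd v.1 v'.1 ∧ 0 < edgeFst v.1 v'.1

/-- The vertices of the graph `G**_θ`: the vertices `v` of `G_θ` such that `BH_v` exists. (This
does not depend on the representative `t` of `v`, so asking for one is enough.) -/
abbrev VertexStarStar (θ : Fin 5 → ℝ) : Type :=
  {v : Vertex θ // ∃ t : Fin 5 → ℝ, v.1 = triple t ∧ BHThetaExists t}

/-- The graph `G**_θ`: the vertices `v` of `G*_θ` such that `BH_v` exists, with all the edges of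
`G*_θ` between them. -/
def graphStarStar (θ : Fin 5 → ℝ) : Digraph (VertexStarStar θ) where
  Adj v v' := (graphStar θ).Adj v.1 v'.1

/-- The distribution `β^{(v, v')}` attached to an edge `(v, v')`. -/
def edgeLaw (v v' : Triple) : Measure ℝ := betaSecondKind (edgeFst v v') (edgeSnd v v')

/-! ### Finite continued fractions -/

/-- The Moebius transformation `H_w(x) = 1 / (1 + w x)`. -/
def moebius (w x : ℝ) : ℝ := 1 / (1 + w * x)

/-- `contFrac n w x = (H_{wₙ} ∘ ⋯ ∘ H_{w₁})(x)`, where `(w₁, …, wₙ) = (w 0, …, w (n - 1))`; the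
last entry is applied last. -/
def contFrac : (n : ℕ) → (Fin n → ℝ) → ℝ → ℝ
  | 0, _, x => x
  | n + 1, w, x => moebius (w (Fin.last n)) (contFrac n (fun i => w i.castSucc) x)

end

end BetaHypergeometric

open BetaHypergeometric

open MeasureTheory ProbabilityTheory Set Filter Topology

namespace BetaHypergeometric

/-! By induction on the path it suffices to treat one edge: `X ∼ BH(a, b, p, q, r)` and an
independent `W` with parameters `c, d`, where `r = a + d` and `c + d = r + b - q`. Given `X = x`,
the variable `1 / (1 + W x)` has density `x ^ d * y ^ (d - 1) * (1 - y) ^ (c - 1) * (1 - y * (1 -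
x)) ^ (-(c + d))` up to the factor `1 / B(c, d)` (`lintegral_betaSecondKind_moebius`). Integrated
against the law of `X`, the factor `x ^ d` turns `a` into `r`, and what is left is a constant times
`₂F₁ b (r + b - p - q) (r + b - p) y` (`lintegral_bhNum_mul_rpow`): expand the last power binomially
and use that the moments of `1 - x` are quotients of Pochhammer symbols, by a contiguous relation at
`1` (`tsum_hgCoeff_add_one`). Hence the new density is proportional to the required one
(`map_moebius_scaledBH`), and total mass one fixes the constant (`scaledBH_eq_bh`).

The law depends only on the triple because of Euler's transformation and the symmetry in `p, q`
(`bhThetaExists_and_bhNum_eq_of_triple_eq`). Integrability at `1` is never estimated: it is read off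
from the law of `X` being a probability measure. -/

/-! ### Hypergeometric coefficients and series -/

/-- The coefficients `(p)ₙ (q)ₙ / (n! (r)ₙ)` of the series `₂F₁(p, q; r; x)`. -/
noncomputable def hgCoeff (p q r : ℝ) (n : ℕ) : ℝ :=
  (ascPochhammer ℝ n).eval p * (ascPochhammer ℝ n).eval q /
    ((n.factorial : ℝ) * (ascPochhammer ℝ n).eval r)

lemma ascPochhammer_eval_ne_zero {r : ℝ} (hr : ∀ n : ℕ, r ≠ -(n : ℝ)) (n : ℕ) :
    (ascPochhammer ℝ n).eval r ≠ 0 := by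
  induction n with
  | zero => simp
  | succ n ih =>
    rw [ascPochhammer_succ_eval]
    exact mul_ne_zero ih fun h => hr n (by linarith)

lemma add_natCast_ne_zero {r : ℝ} (hr : ∀ n : ℕ, r ≠ -(n : ℝ)) (n : ℕ) : r + n ≠ 0 :=
  fun h => hr n (by linarith)

lemma ne_neg_natCast_of_pos {r : ℝ} (hr : 0 < r) (n : ℕ) : r ≠ -(n : ℝ) := by
  have : (0 : ℝ) ≤ n := n.cast_nonneg
  intro h
  linarith

@[simp] lemma hgCoeff_zero (p q r : ℝ) : hgCoeff p q r 0 = 1 := by simp [hgCoeff]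

lemma hgCoeff_succ {r : ℝ} (hr : ∀ n : ℕ, r ≠ -(n : ℝ)) (p q : ℝ) (n : ℕ) :
    hgCoeff p q r (n + 1) * ((n + 1) * (r + n)) = (p + n) * (q + n) * hgCoeff p q r n := by
  have h1 := ascPochhammer_eval_ne_zero hr n
  have h2 := add_natCast_ne_zero hr n
  have h3 : (n.factorial : ℝ) ≠ 0 := by positivity
  have h4 : (n + 1 : ℝ) ≠ 0 := by positivity
  simp only [hgCoeff, ascPochhammer_succ_eval, Nat.factorial_succ]
  push_cast
  field_simp

lemma eq_hgCoeff_of_recurrence {r : ℝ} (hr : ∀ n : ℕ, r ≠ -(n : ℝ)) {p q : ℝ} {u : ℕ → ℝ}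
    (h0 : u 0 = 1)
    (hu : ∀ n : ℕ, u (n + 1) * ((n + 1) * (r + n)) = (p + n) * (q + n) * u n) (n : ℕ) :
    u n = hgCoeff p q r n := by
  induction n with
  | zero => simp [h0]
  | succ n ih =>
    have h2 := add_natCast_ne_zero hr n
    have h4 : (n + 1 : ℝ) ≠ 0 := by positivity
    apply mul_right_cancel₀ (mul_ne_zero h4 h2)
    rw [hu, hgCoeff_succ hr, ih]

lemma ordinaryHypergeometric_eq_tsum_hgCoeff (p q r x : ℝ) :
    ₂F₁ p q r x = ∑' n, hgCoeff p q r n * x ^ n := by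
  rw [ordinaryHypergeometric_eq_tsum]
  refine tsum_congr fun n => ?_
  simp only [hgCoeff, smul_eq_mul, div_eq_mul_inv, mul_inv]
  ring

lemma hgCoeff_comm (p q r : ℝ) (n : ℕ) : hgCoeff p q r n = hgCoeff q p r n := by
  simp only [hgCoeff, mul_comm]

lemma ordinaryHypergeometric_comm (p q r x : ℝ) : ₂F₁ p q r x = ₂F₁ q p r x := by
  simp only [ordinaryHypergeometric_eq_tsum_hgCoeff, hgCoeff_comm p q r]

lemma tendsto_natCast_add_div (p r : ℝ) :
    Tendsto (fun n : ℕ => (p + n) / (r + n)) atTop (𝓝 1) := by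
  have := tendsto_add_mul_div_add_mul_atTop_nhds p r (1 : ℝ) (one_ne_zero (α := ℝ))
  simpa using this

lemma summable_norm_hgCoeff_mul_pow {r : ℝ} (hr : ∀ n : ℕ, r ≠ -(n : ℝ)) (p q : ℝ) {x : ℝ}
    (hx : |x| < 1) : Summable fun n => ‖hgCoeff p q r n * x ^ n‖ := by
  obtain ⟨l, hl, hl1⟩ := exists_between hx
  have hlim : Tendsto (fun n : ℕ => |(p + n) / (1 + n) * ((q + n) / (r + n)) * x|) atTop
      (𝓝 |1 * 1 * x|) :=
    (((tendsto_natCast_add_div p 1).mul (tendsto_natCast_add_div q r)).mul_const x).abs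
  rw [one_mul, one_mul] at hlim
  refine summable_of_ratio_norm_eventually_le hl1 ?_
  filter_upwards [hlim.eventually_le_const hl] with n hn
  have h2 := add_natCast_ne_zero hr n
  have h4 : (1 + n : ℝ) ≠ 0 := by positivity
  have : hgCoeff p q r (n + 1) * x ^ (n + 1) =
      (p + n) / (1 + n) * ((q + n) / (r + n)) * x * (hgCoeff p q r n * x ^ n) := by
    have := hgCoeff_succ hr p q n
    field_simp
    rw [pow_succ]
    linear_combination x ^ n * x * this
  rw [norm_norm, norm_norm, this, norm_mul, Real.norm_eq_abs (_ * x)]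
  gcongr

lemma hasSum_ordinaryHypergeometric {r : ℝ} (hr : ∀ n : ℕ, r ≠ -(n : ℝ)) (p q : ℝ) {x : ℝ}
    (hx : |x| < 1) : HasSum (fun n => hgCoeff p q r n * x ^ n) (₂F₁ p q r x) := by
  rw [ordinaryHypergeometric_eq_tsum_hgCoeff]
  exact (summable_norm_hgCoeff_mul_pow hr p q hx).of_norm.hasSum

/-- The coefficients of a hypergeometric series have an eventually constant sign. -/
lemma exists_forall_hgCoeff_sign {r : ℝ} (hr : ∀ n : ℕ, r ≠ -(n : ℝ)) (p q : ℝ) :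
    ∃ (K : ℕ) (σ : ℝ), |σ| = 1 ∧ ∀ k ≥ K, 0 ≤ σ * hgCoeff p q r k := by
  -- From this `K` on, the factors `p + k`, `q + k`, `r + k` of the recurrence are nonnegative, so
  -- the sign of the coefficient at `K` persists.
  obtain ⟨K, hK⟩ := exists_nat_ge (max (-p) (max (-q) (-r)))
  simp only [max_le_iff] at hK
  obtain ⟨hp, hq, hr'⟩ := hK
  obtain ⟨σ, hσ, h0⟩ : ∃ σ : ℝ, |σ| = 1 ∧ 0 ≤ σ * hgCoeff p q r K := by
    rcases le_total 0 (hgCoeff p q r K) with h | h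
    · exact ⟨1, by simp, by simpa⟩
    · exact ⟨-1, by simp, by simpa⟩
  refine ⟨K, σ, hσ, fun k hk => ?_⟩
  induction k, hk using Nat.le_induction with
  | base => exact h0
  | succ k hk ih =>
    have hk' : (K : ℝ) ≤ k := by exact_mod_cast hk
    have h2 : 0 < r + k := lt_of_le_of_ne (by linarith) (add_natCast_ne_zero hr k).symm
    have h3 : 0 < (k + 1 : ℝ) * (r + k) := by positivity
    refine nonneg_of_mul_nonneg_left (b := (k + 1 : ℝ) * (r + k)) ?_ h3
    rw [mul_assoc, hgCoeff_succ hr]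
    have : 0 ≤ (p + k) * (q + k) := mul_nonneg (by linarith) (by linarith)
    calc 0 ≤ (p + k) * (q + k) * (σ * hgCoeff p q r k) := mul_nonneg this ih
      _ = _ := by ring

/-- The binomial series `(1 - x)^(-e) = ∑ (e)ₙ / n! xⁿ`. -/
lemma hasSum_one_sub_rpow_neg (e : ℝ) {x : ℝ} (hx : |x| < 1) :
    HasSum (fun n => hgCoeff e 1 1 n * x ^ n) ((1 - x) ^ (-e)) := by
  have h := (Real.one_div_one_sub_rpow_hasFPowerSeriesOnBall_zero e).hasSum (y := x)
    (by simpa [enorm_eq_nnnorm, ← NNReal.coe_lt_coe] using hx)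
  have h1 : 0 ≤ 1 - x := by linarith [abs_lt.1 hx]
  rw [zero_add, one_div, ← Real.rpow_neg h1] at h
  suffices H : (fun n => hgCoeff e 1 1 n * x ^ n) = fun n => FormalMultilinearSeries.ofScalars ℝ
      (fun n : ℕ => Ring.choose (e + n - 1) n) n fun _ => x by
    rw [H]
    exact h
  funext n
  have h3 : (n.factorial : ℝ) ≠ 0 := by positivity
  have h5 := ascPochhammer_eval_ne_zero (r := 1) (ne_neg_natCast_of_pos one_pos) n
  have h6 := Ring.factorial_nsmul_multichoose_eq_ascPochhammer e n
  rw [Polynomial.ascPochhammer_smeval_eq_eval, nsmul_eq_mul] at h6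
  rw [FormalMultilinearSeries.ofScalars_apply_eq, smul_eq_mul, hgCoeff, ← h6,
    Ring.multichoose_eq]
  field_simp

/-! ### Euler's transformation -/

section Euler

open PowerSeries

/-- The hypergeometric differential equation for a formal series amounts to the recurrence of
`hgCoeff`, so a solution with constant term 1 is unique. -/
lemma coeff_hypergeometricOperator (p q r : ℝ) (u : ℝ⟦X⟧) (n : ℕ) :
    coeff n (X * ((1 - X) * d⁄dX ℝ (d⁄dX ℝ u)) + (C r - C (p + q + 1) * X) * d⁄dX ℝ u -
      C (p * q) * u) =
    coeff (n + 1) u * ((n + 1) * (r + n)) - (p + n) * (q + n) * coeff n u := by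
  have h : X * ((1 - X) * d⁄dX ℝ (d⁄dX ℝ u)) + (C r - C (p + q + 1) * X) * d⁄dX ℝ u -
      C (p * q) * u = X * d⁄dX ℝ (d⁄dX ℝ u) - X * (X * d⁄dX ℝ (d⁄dX ℝ u)) + C r * d⁄dX ℝ u -
      C (p + q + 1) * (X * d⁄dX ℝ u) - C (p * q) * u := by ring
  rw [h]
  -- An opaque constant, so that `map_add` does not split it inside `C`.
  generalize hs : p + q + 1 = s
  generalize hm : p * q = m
  -- `X * (X * u'')` shifts by two, so the coefficients 0 and 1 are separate cases.
  rcases n with _ | _ | n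
  all_goals
    simp only [map_sub, map_add, coeff_C_mul, coeff_succ_X_mul, coeff_zero_X_mul,
      coeff_derivative]
    subst hs hm
    push_cast
    ring

lemma ode_mk_hgCoeff {r : ℝ} (hr : ∀ n : ℕ, r ≠ -(n : ℝ)) (p q : ℝ) :
    X * ((1 - X) * d⁄dX ℝ (d⁄dX ℝ (mk (hgCoeff p q r)))) +
      (C r - C (p + q + 1) * X) * d⁄dX ℝ (mk (hgCoeff p q r)) -
      C (p * q) * mk (hgCoeff p q r) = 0 := by
  ext n
  rw [coeff_hypergeometricOperator, coeff_mk, coeff_mk, hgCoeff_succ hr]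
  simp

/-- The first-order equation that characterizes `(1 - X) ^ (-e)`. -/
lemma one_sub_X_mul_derivative_mk_hgCoeff (e : ℝ) :
    (1 - X) * d⁄dX ℝ (mk (hgCoeff e 1 1)) = C e * mk (hgCoeff e 1 1) := by
  ext n
  have h1 : ∀ n : ℕ, (n + 1 : ℝ) * hgCoeff e 1 1 (n + 1) = (e + n) * hgCoeff e 1 1 n := by
    intro n
    have h := hgCoeff_succ (r := 1) (ne_neg_natCast_of_pos one_pos) e 1 n
    have h4 : (1 + n : ℝ) ≠ 0 := by positivity
    apply mul_left_cancel₀ h4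
    linear_combination h
  rw [sub_mul, one_mul, map_sub, coeff_C_mul, coeff_mk, coeff_derivative, coeff_mk]
  rcases n with _ | n
  · have := h1 0
    simp at this ⊢
    exact this
  · have := h1 (n + 1)
    rw [coeff_succ_X_mul, coeff_derivative, coeff_mk]
    push_cast at this ⊢
    linear_combination this

/-- Euler's transformation, for formal power series. -/
lemma mk_hgCoeff_euler {r : ℝ} (hr : ∀ n : ℕ, r ≠ -(n : ℝ)) (p q : ℝ) :
    mk (hgCoeff p q r) =
      mk (hgCoeff (p + q - r) 1 1) * mk (hgCoeff (r - p) (r - q) r) := by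
  have hG := ode_mk_hgCoeff hr (r - p) (r - q)
  have hB := one_sub_X_mul_derivative_mk_hgCoeff (p + q - r)
  set G := mk (hgCoeff (r - p) (r - q) r)
  set B := mk (hgCoeff (p + q - r) 1 1)
  have hB' := congrArg (d⁄dX ℝ) hB
  simp only [Derivation.leibniz, map_sub, derivative_X, derivative_C, derivative_one,
    smul_eq_mul] at hB'
  -- The product solves the equation with parameters `p, q, r`: `hB` and its derivative `hB'`
  -- eliminate the derivatives of `B`, leaving the equation for `G`.
  have hode : X * ((1 - X) * d⁄dX ℝ (d⁄dX ℝ (B * G))) +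
      (C r - C (p + q + 1) * X) * d⁄dX ℝ (B * G) - C (p * q) * (B * G) = 0 := by
    simp only [Derivation.leibniz, map_add, smul_eq_mul]
    simp only [map_add, map_sub, map_mul, map_one] at hG hB hB' ⊢
    linear_combination B * hG + X * G * hB' + (2 * X * d⁄dX ℝ G + C r * G) * hB
  ext n
  rw [coeff_mk]
  refine (eq_hgCoeff_of_recurrence (u := fun n => coeff n (B * G)) hr ?_ (fun n => ?_) n).symm
  · simp [B, G, coeff_mul, -coeff_zero_eq_constantCoeff]
  · have := congrArg (coeff n) hode
    rw [coeff_hypergeometricOperator, map_zero, sub_eq_zero] at this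
    exact this

end Euler

/-- Euler's transformation. -/
lemma ordinaryHypergeometric_euler {r : ℝ} (hr : ∀ n : ℕ, r ≠ -(n : ℝ)) (p q : ℝ) {x : ℝ}
    (hx : |x| < 1) : ₂F₁ p q r x = (1 - x) ^ (r - p - q) * ₂F₁ (r - p) (r - q) r x := by
  have h1 := summable_norm_hgCoeff_mul_pow (ne_neg_natCast_of_pos one_pos) (p + q - r) 1 hx
  have h2 := summable_norm_hgCoeff_mul_pow hr (r - p) (r - q) hx
  have h3 := tsum_mul_tsum_eq_tsum_sum_antidiagonal_of_summable_norm h1 h2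
  rw [(hasSum_one_sub_rpow_neg _ hx).tsum_eq, ← ordinaryHypergeometric_eq_tsum_hgCoeff] at h3
  rw [show r - p - q = -(p + q - r) by ring, h3, ordinaryHypergeometric_eq_tsum_hgCoeff]
  refine tsum_congr fun n => ?_
  have h4 := congrArg (PowerSeries.coeff n) (mk_hgCoeff_euler hr p q)
  rw [PowerSeries.coeff_mk, PowerSeries.coeff_mul] at h4
  simp only [PowerSeries.coeff_mk] at h4
  rw [h4, Finset.sum_mul]
  refine Finset.sum_congr rfl fun kl hkl => ?_
  rw [← Finset.HasAntidiagonal.mem_antidiagonal.1 hkl, pow_add]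
  ring

/-! ### Beta integrals and termwise integration -/

lemma integrableOn_beta_kernel {a b : ℝ} (ha : 0 < a) (hb : 0 < b) :
    IntegrableOn (fun x : ℝ => x ^ (a - 1) * (1 - x) ^ (b - 1)) (Ioo 0 1) ∧
      ∫ x in Ioo (0 : ℝ) 1, x ^ (a - 1) * (1 - x) ^ (b - 1) = ProbabilityTheory.beta a b := by
  have hB := beta_pos ha hb
  have h := lintegral_betaPDF_eq_one ha hb
  rw [lintegral_betaPDF] at h
  have hnn : 0 ≤ᵐ[volume.restrict (Ioo (0 : ℝ) 1)]
      fun x => 1 / ProbabilityTheory.beta a b * x ^ (a - 1) * (1 - x) ^ (b - 1) := by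
    refine ae_restrict_of_forall_mem measurableSet_Ioo fun x hx => ?_
    have : 0 < 1 - x := by linarith [hx.2]
    have := hx.1
    positivity
  have hint : IntegrableOn
      (fun x => 1 / ProbabilityTheory.beta a b * x ^ (a - 1) * (1 - x) ^ (b - 1)) (Ioo 0 1) := by
    refine (lintegral_ofReal_ne_top_iff_integrable ?_ hnn).1 (by rw [h]; simp)
    exact Measurable.aestronglyMeasurable (by fun_prop)
  have h1 := ofReal_integral_eq_lintegral_ofReal hint hnn
  rw [h] at h1
  have h2 := (ENNReal.ofReal_eq_one).1 h1
  simp_rw [mul_assoc] at h2 hint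
  rw [integral_const_mul] at h2
  refine ⟨?_, by field_simp at h2; linarith⟩
  have h3 := hint.const_mul (ProbabilityTheory.beta a b)
  simp_rw [← mul_assoc, mul_one_div_cancel hB.ne', one_mul] at h3
  exact h3

lemma beta_add_natCast {a b : ℝ} (ha : 0 < a) (hb : 0 < b) (n : ℕ) :
    ProbabilityTheory.beta (a + n) b = ProbabilityTheory.beta a b *
      ((ascPochhammer ℝ n).eval a / (ascPochhammer ℝ n).eval (a + b)) := by
  induction n with
  | zero => simp
  | succ n ih =>
    have h1 : 0 < a + n := by positivity
    have h2 : 0 < a + b + n := by positivity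
    have h3 := Real.Gamma_pos_of_pos (show 0 < a + n + b by positivity)
    have h4 := ascPochhammer_pos n (a + b) (by positivity)
    rw [ascPochhammer_succ_eval, ascPochhammer_succ_eval, mul_div_mul_comm, ← mul_assoc, ← ih,
      beta, beta, Nat.cast_succ, show a + (n + 1 : ℝ) + b = (a + n + b) + 1 by ring,
      ← add_assoc, Real.Gamma_add_one h1.ne', Real.Gamma_add_one (by positivity)]
    have : a + n + b = a + b + n := by ring
    rw [this] at h3 ⊢
    field_simp

/-- Termwise integration of a series whose terms have eventually the same sign. -/
lemma hasSum_integral_of_eventually_sign {α : Type*} {m : MeasurableSpace α} {μ : Measure α}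
    {f : ℕ → α → ℝ} {F : α → ℝ} (hf : ∀ k, Integrable (f k) μ) (hF : Integrable F μ)
    (hsum : ∀ᵐ x ∂μ, HasSum (fun k => f k x) (F x)) {K : ℕ} {σ : ℝ} (hσ : |σ| = 1)
    (hs : ∀ k ≥ K, ∀ᵐ x ∂μ, 0 ≤ σ * f k x) :
    HasSum (fun k => ∫ x, f k x ∂μ) (∫ x, F x ∂μ) := by
  have hsum' : Summable fun k => ∫ x, ‖f k x‖ ∂μ := by
    rw [← summable_nat_add_iff K]
    -- Past `K` the absolute values are `σ * f`, so their partial sums lie below `σ` times the tail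
    -- `F - ∑ i < K, f i`, which is integrable.
    refine summable_of_sum_range_le (c := ∫ x, σ * (F x - ∑ i ∈ Finset.range K, f i x) ∂μ)
      (fun n => integral_nonneg fun x => norm_nonneg _) fun n => ?_
    rw [← integral_finsetSum _ fun i _ => (hf _).norm]
    refine integral_mono_ae (integrable_finsetSum _ fun i _ => (hf _).norm)
      ((hF.sub (integrable_finsetSum _ fun i _ => hf i)).const_mul σ) ?_
    have hs' : ∀ᵐ x ∂μ, ∀ i, 0 ≤ σ * f (i + K) x :=
      ae_all_iff.2 fun i => hs (i + K) (by omega)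
    filter_upwards [hsum, hs'] with x hx hsx
    have hx' := ((hasSum_nat_add_iff' K).2 hx).mul_left σ
    have habs : ∀ i, ‖f (i + K) x‖ = σ * f (i + K) x := fun i => by
      rw [← abs_of_nonneg (hsx i), abs_mul, hσ, one_mul, Real.norm_eq_abs]
    simp only [habs]
    exact sum_le_hasSum _ (fun i _ => hsx i) hx'
  have := hasSum_integral_of_summable_integral_norm hf hsum'
  rwa [integral_congr_ae (hsum.mono fun x hx => hx.tsum_eq)] at this

/-! ### The density and its normalization -/

/-- The unnormalized density of the beta hypergeometric distribution. -/
noncomputable def bhNum (a b p q r x : ℝ) : ℝ := x ^ (a - 1) * (1 - x) ^ (b - 1) * ₂F₁ p q r x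

lemma hasSum_bhNum {r : ℝ} (hr : ∀ n : ℕ, r ≠ -(n : ℝ)) (a b p q : ℝ) {x : ℝ}
    (hx : x ∈ Ioo (0 : ℝ) 1) :
    HasSum (fun k : ℕ => hgCoeff p q r k * (x ^ (a + k - 1) * (1 - x) ^ (b - 1)))
      (bhNum a b p q r x) := by
  have h := (hasSum_ordinaryHypergeometric hr p q (x := x) (by
    rw [abs_of_pos hx.1]; exact hx.2)).mul_left (x ^ (a - 1) * (1 - x) ^ (b - 1))
  have heq : (fun k : ℕ => hgCoeff p q r k * (x ^ (a + k - 1) * (1 - x) ^ (b - 1))) =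
      fun k => x ^ (a - 1) * (1 - x) ^ (b - 1) * (hgCoeff p q r k * x ^ k) := by
    funext k
    rw [show a + k - 1 = a - 1 + k by ring, Real.rpow_add_natCast hx.1.ne']
    ring
  rw [heq]
  exact h

lemma aestronglyMeasurable_bhNum {r : ℝ} (hr : ∀ n : ℕ, r ≠ -(n : ℝ)) (a b p q : ℝ) :
    AEStronglyMeasurable (bhNum a b p q r) (volume.restrict (Ioo 0 1)) := by
  refine aestronglyMeasurable_of_tendsto_ae (u := atTop) (f := fun n x => ∑ k ∈ Finset.range n,
    hgCoeff p q r k * (x ^ (a + k - 1) * (1 - x) ^ (b - 1))) (fun n => ?_) ?_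
  · exact Measurable.aestronglyMeasurable (by fun_prop)
  · exact ae_restrict_of_forall_mem measurableSet_Ioo fun x hx =>
      (hasSum_bhNum hr a b p q hx).tendsto_sum_nat

/-- The coefficients may change sign, but only finitely often; together with integrability of the
sum this justifies termwise integration. -/
lemma hasSum_integral_bhNum {a b p q r : ℝ} (ha : 0 < a) (hb : 0 < b)
    (hr : ∀ n : ℕ, r ≠ -(n : ℝ)) (hint : IntegrableOn (bhNum a b p q r) (Ioo 0 1)) :
    HasSum (fun k : ℕ => hgCoeff p q r k * ProbabilityTheory.beta (a + k) b)
      (∫ x in Ioo 0 1, bhNum a b p q r x) := by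
  obtain ⟨K, σ, hσ, hK⟩ := exists_forall_hgCoeff_sign hr p q
  have hak : ∀ k : ℕ, 0 < a + k := fun k => by positivity
  have h := hasSum_integral_of_eventually_sign
    (f := fun (k : ℕ) x => hgCoeff p q r k * (x ^ (a + k - 1) * (1 - x) ^ (b - 1)))
    (fun k => (integrableOn_beta_kernel (hak k) hb).1.const_mul _) hint
    (ae_restrict_of_forall_mem measurableSet_Ioo fun x hx => hasSum_bhNum hr a b p q hx) hσ
    (fun k hk => ae_restrict_of_forall_mem measurableSet_Ioo fun x hx => by
      have h1 : 0 < 1 - x := by linarith [hx.2]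
      have h2 := hx.1
      have h3 := hK k hk
      rw [← mul_assoc]
      positivity)
  simpa only [integral_const_mul, (integrableOn_beta_kernel (hak _) hb).2] using h

lemma integral_bhNum {a b p q r : ℝ} (ha : 0 < a) (hb : 0 < b)
    (hr : ∀ n : ℕ, r ≠ -(n : ℝ)) (hint : IntegrableOn (bhNum a b p q r) (Ioo 0 1)) :
    ∫ x in Ioo 0 1, bhNum a b p q r x =
      ProbabilityTheory.beta a b * hypergeometric32 a p q r (a + b) 1 := by
  rw [← (hasSum_integral_bhNum ha hb hr hint).tsum_eq, hypergeometric32, ← tsum_mul_left]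
  refine tsum_congr fun n => ?_
  have h1 := ascPochhammer_pos n (a + b) (by positivity)
  have h2 := ascPochhammer_eval_ne_zero hr n
  rw [beta_add_natCast ha hb, hgCoeff]
  field_simp
  simp

lemma bhNum_pos {a b p q r x : ℝ} (h : BHParam a b p q r) (hx : x ∈ Ioo (0 : ℝ) 1) :
    0 < bhNum a b p q r x := by
  have h1 : 0 < 1 - x := by linarith [hx.2]
  have h2 := hx.1
  have h3 := h.hypergeometric_pos x hx
  unfold bhNum
  positivity

/-- The measure on `(0, 1)` with density `κ` times the unnormalized beta hypergeometric density. -/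
noncomputable def scaledBH (κ a b p q r : ℝ) : Measure ℝ :=
  (volume.restrict (Ioo 0 1)).withDensity fun x => ENNReal.ofReal (κ * bhNum a b p q r x)

lemma bh_eq_scaledBH (a b p q r : ℝ) : bh a b p q r =
    scaledBH (ProbabilityTheory.beta a b * hypergeometric32 a p q r (a + b) 1)⁻¹ a b p q r := by
  simp only [bh, scaledBH, bhNum, div_eq_inv_mul]

lemma scaledBH_congr {κ a b p q r a' b' p' q' r' : ℝ}
    (h : ∀ x ∈ Ioo (0 : ℝ) 1, bhNum a b p q r x = bhNum a' b' p' q' r' x) :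
    scaledBH κ a b p q r = scaledBH κ a' b' p' q' r' := by
  refine withDensity_congr_ae (ae_restrict_of_forall_mem measurableSet_Ioo fun x hx => ?_)
  simp only [h x hx]

/-- Total mass one makes the lower integral of a positive function finite, which is integrability. A
nonpositive `κ` would give the zero measure, because `ENNReal.ofReal` truncates. -/
lemma of_isProbabilityMeasure_scaledBH {κ a b p q r : ℝ} (h : BHParam a b p q r)
    [hP : IsProbabilityMeasure (scaledBH κ a b p q r)] :
    0 < κ ∧ IntegrableOn (bhNum a b p q r) (Ioo 0 1) ∧
      κ * ∫ x in Ioo 0 1, bhNum a b p q r x = 1 := by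
  have h1 := hP.measure_univ
  rw [scaledBH, withDensity_apply _ MeasurableSet.univ, Measure.restrict_univ] at h1
  have hκ : 0 < κ := by
    by_contra hκ
    rw [setLIntegral_congr_fun (g := fun _ => 0) measurableSet_Ioo fun x hx =>
      ENNReal.ofReal_of_nonpos
        (mul_nonpos_of_nonpos_of_nonneg (not_lt.1 hκ) (bhNum_pos h hx).le)] at h1
    simp at h1
  have hnn : 0 ≤ᵐ[volume.restrict (Ioo (0 : ℝ) 1)] fun x => κ * bhNum a b p q r x :=
    ae_restrict_of_forall_mem measurableSet_Ioo fun x hx => (mul_pos hκ (bhNum_pos h hx)).le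
  have hint : IntegrableOn (fun x => κ * bhNum a b p q r x) (Ioo 0 1) :=
    (lintegral_ofReal_ne_top_iff_integrable
      ((aestronglyMeasurable_bhNum h.not_pole a b p q).const_mul κ) hnn).1 (by rw [h1]; simp)
  have h2 := ofReal_integral_eq_lintegral_ofReal hint hnn
  rw [h1, ENNReal.ofReal_eq_one, integral_const_mul] at h2
  refine ⟨hκ, ?_, h2⟩
  have h3 := hint.const_mul κ⁻¹
  simp_rw [← mul_assoc, inv_mul_cancel₀ hκ.ne', one_mul] at h3
  exact h3

/-- A probability measure proportional to the beta hypergeometric density is the beta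
hypergeometric distribution. -/
lemma scaledBH_eq_bh {κ a b p q r : ℝ} (h : BHParam a b p q r)
    [IsProbabilityMeasure (scaledBH κ a b p q r)] : scaledBH κ a b p q r = bh a b p q r := by
  obtain ⟨-, hint, h1⟩ := of_isProbabilityMeasure_scaledBH (κ := κ) h
  rw [bh_eq_scaledBH, ← integral_bhNum h.a_pos h.b_pos h.not_pole hint,
    ← eq_inv_of_mul_eq_one_left h1]

/-! ### Symmetries in the parameters -/

lemma BHParam.comm {a b p q r : ℝ} (h : BHParam a b p q r) : BHParam a b q p r where
  not_pole := h.not_pole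
  hypergeometric_pos x hx := by
    rw [ordinaryHypergeometric_comm]
    exact h.hypergeometric_pos x hx
  a_pos := h.a_pos
  b_pos := h.b_pos
  s_pos := by linarith [h.s_pos]

lemma bhNum_comm (a b p q r x : ℝ) : bhNum a b p q r x = bhNum a b q p r x := by
  rw [bhNum, bhNum, ordinaryHypergeometric_comm]

lemma bhNum_euler {a b p q r x : ℝ} (hr : ∀ n : ℕ, r ≠ -(n : ℝ)) (hx : x ∈ Ioo (0 : ℝ) 1) :
    bhNum a b p q r x = bhNum a (r + b - p - q) (r - p) (r - q) r x := by
  have h1 : 0 < 1 - x := by linarith [hx.2]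
  rw [bhNum, bhNum, ordinaryHypergeometric_euler hr p q (by rw [abs_of_pos hx.1]; exact hx.2),
    show r + b - p - q - 1 = (b - 1) + (r - p - q) by ring, Real.rpow_add h1]
  ring

/-- Euler's transformation exchanges `b` and `r + b - p - q`, hence the two positivity conditions on
them. -/
lemma BHParam.euler {a b p q r : ℝ} (h : BHParam a b p q r) :
    BHParam a (r + b - p - q) (r - p) (r - q) r where
  not_pole := h.not_pole
  hypergeometric_pos x hx := by
    have h1 : 0 < 1 - x := by linarith [hx.2]
    have h2 := h.hypergeometric_pos x hx
    rw [ordinaryHypergeometric_euler h.not_pole p q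
      (by rw [abs_of_pos hx.1]; exact hx.2)] at h2
    exact pos_of_mul_pos_right h2 (by positivity)
  a_pos := h.a_pos
  b_pos := h.s_pos
  s_pos := by linarith [h.b_pos]

/-- Two beta hypergeometric distributions with proportional densities are equal. -/
lemma bh_eq_of_bhNum_eq {a b p q r a' b' p' q' r' : ℝ} (h' : BHParam a' b' p' q' r')
    (heq : ∀ x ∈ Ioo (0 : ℝ) 1, bhNum a b p q r x = bhNum a' b' p' q' r' x)
    [hP : IsProbabilityMeasure (bh a b p q r)] : bh a b p q r = bh a' b' p' q' r' := by
  rw [bh_eq_scaledBH, scaledBH_congr heq] at hP ⊢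
  exact scaledBH_eq_bh h'

/-! ### A contiguous relation at `1` and the moments of `1 - x` -/

lemma ascPochhammer_eval_add_one_mul (γ : ℝ) (n : ℕ) :
    (ascPochhammer ℝ n).eval (γ + 1) * γ = (ascPochhammer ℝ n).eval γ * (γ + n) := by
  induction n with
  | zero => simp
  | succ n ih =>
    rw [ascPochhammer_succ_eval, ascPochhammer_succ_eval]
    push_cast
    linear_combination (γ + 1 + n) * ih

lemma hgCoeff_add_one {γ : ℝ} (hγ : 0 < γ) (p q : ℝ) (n : ℕ) :
    hgCoeff p q (γ + 1) n = γ / (γ + n) * hgCoeff p q γ n := by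
  have h1 := ascPochhammer_pos n γ hγ
  have h2 := ascPochhammer_pos n (γ + 1) (by positivity)
  have h3 : 0 < γ + n := by positivity
  rw [hgCoeff, hgCoeff]
  field_simp
  linear_combination -(ascPochhammer ℝ n).eval p * (ascPochhammer ℝ n).eval q *
    ascPochhammer_eval_add_one_mul γ n

/-- If `∑ tₙ` converges absolutely and `n tₙ` converges, then `n tₙ → 0`. -/
lemma eq_zero_of_tendsto_natCast_mul {t : ℕ → ℝ} {L : ℝ} (ht : Summable t)
    (hL : Tendsto (fun n : ℕ => n * t n) atTop (𝓝 L)) : L = 0 := by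
  by_contra hne
  have habs : 0 < |L| := abs_pos.2 hne
  -- Then `1 / n ≤ (2 / |L|) * |t n|` eventually, and the harmonic series would converge.
  have h1 : ∀ᶠ n : ℕ in atTop, |L| / 2 < |n * t n| :=
    hL.abs.eventually_const_lt (by linarith)
  refine Real.not_summable_natCast_inv ?_
  refine Summable.of_norm_bounded_eventually_nat (g := fun n => 2 / |L| * |t n|)
    (ht.abs.mul_left _) ?_
  filter_upwards [h1, eventually_gt_atTop 0] with n hn hn0
  have hn0' : (0 : ℝ) < n := by exact_mod_cast hn0
  rw [abs_mul, abs_of_pos hn0'] at hn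
  rw [Real.norm_of_nonneg (by positivity)]
  field_simp
  linarith

/-- The contiguous relation behind Gauss's summation theorem. -/
lemma tsum_hgCoeff_add_one {γ p q : ℝ} (hγ : 0 < γ) (hs : Summable (hgCoeff p q γ))
    (hs' : Summable (hgCoeff p q (γ + 1))) :
    (γ - p) * (γ - q) * ∑' n, hgCoeff p q (γ + 1) n = γ * (γ - p - q) * ∑' n, hgCoeff p q γ n := by
  -- The difference of the two sides telescopes. Its boundary term has a limit because both series
  -- converge, and that limit is 0 by `eq_zero_of_tendsto_natCast_mul`.
  have htel : ∀ N : ℕ, ∑ n ∈ Finset.range N, (γ * (γ - p - q) * hgCoeff p q γ n -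
      (γ - p) * (γ - q) * hgCoeff p q (γ + 1) n) = -γ * (N * hgCoeff p q γ N) := by
    intro N
    induction N with
    | zero => simp
    | succ N ih =>
      have h1 := hgCoeff_succ (ne_neg_natCast_of_pos hγ) p q N
      have h3 : 0 < γ + N := by positivity
      rw [Finset.sum_range_succ, ih, hgCoeff_add_one hγ]
      push_cast
      field_simp
      linear_combination h1
  have hsum := ((hs.hasSum.mul_left (γ * (γ - p - q))).sub
    (hs'.hasSum.mul_left ((γ - p) * (γ - q)))).tendsto_sum_nat
  simp only [htel] at hsum
  have h2 := hsum.const_mul (-γ)⁻¹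
  have hγ' : -γ ≠ 0 := by linarith
  simp only [inv_mul_cancel_left₀ hγ'] at h2
  have h3 := eq_zero_of_tendsto_natCast_mul hs h2
  have h4 := (mul_eq_zero.1 h3).resolve_left (inv_ne_zero hγ')
  linarith

lemma bhNum_add_natCast (a b p q r : ℝ) (n : ℕ) {x : ℝ} (hx : x ∈ Ioo (0 : ℝ) 1) :
    bhNum a (b + n) p q r x = (1 - x) ^ n * bhNum a b p q r x := by
  have h1 : 1 - x ≠ 0 := by linarith [hx.2]
  rw [bhNum, bhNum, show b + n - 1 = b - 1 + n by ring, Real.rpow_add_natCast h1]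
  ring

lemma integrableOn_bhNum_add_natCast {a b p q r : ℝ}
    (hint : IntegrableOn (bhNum a b p q r) (Ioo 0 1)) (n : ℕ) :
    IntegrableOn (bhNum a (b + n) p q r) (Ioo 0 1) := by
  refine IntegrableOn.congr_fun (f := fun x => (1 - x) ^ n * bhNum a b p q r x) ?_
    (fun x hx => (bhNum_add_natCast a b p q r n hx).symm) measurableSet_Ioo
  refine hint.bdd_mul (c := 1) (Measurable.aestronglyMeasurable (by fun_prop)) ?_
  refine ae_restrict_of_forall_mem measurableSet_Ioo fun x hx => ?_
  rw [norm_pow]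
  refine pow_le_one₀ (norm_nonneg _) ?_
  rw [Real.norm_eq_abs, abs_le]
  exact ⟨by linarith [hx.2], by linarith [hx.1]⟩

lemma integrableOn_bhNum_of_le {a a' b p q r : ℝ} (ha : a ≤ a')
    (hr : ∀ n : ℕ, r ≠ -(n : ℝ)) (hint : IntegrableOn (bhNum a b p q r) (Ioo 0 1)) :
    IntegrableOn (bhNum a' b p q r) (Ioo 0 1) := by
  refine Integrable.mono hint (aestronglyMeasurable_bhNum hr a' b p q) ?_
  refine ae_restrict_of_forall_mem measurableSet_Ioo fun x hx => ?_
  have h1 : 0 < 1 - x := by linarith [hx.2]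
  have h2 := hx.1
  simp only [bhNum, norm_mul]
  gcongr ?_ * _ * _
  rw [Real.norm_of_nonneg (by positivity), Real.norm_of_nonneg (by positivity)]
  exact Real.rpow_le_rpow_of_exponent_ge h2 hx.2.le (by linarith)

/-- For `a = r` the factor `(r)ₙ` of the beta integrals cancels the denominators, and the `₃F₂`
collapses to a `₂F₁` at `1`. -/
lemma hasSum_hgCoeff_integral_bhNum {b p q r : ℝ} (hr : 0 < r) (hb : 0 < b)
    (hint : IntegrableOn (bhNum r b p q r) (Ioo 0 1)) :
    HasSum (fun k => ProbabilityTheory.beta r b * hgCoeff p q (r + b) k)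
      (∫ x in Ioo 0 1, bhNum r b p q r x) := by
  have h := hasSum_integral_bhNum hr hb (ne_neg_natCast_of_pos hr) hint
  suffices heq : (fun k => ProbabilityTheory.beta r b * hgCoeff p q (r + b) k) =
      fun k : ℕ => hgCoeff p q r k * ProbabilityTheory.beta (r + k) b by
    rw [heq]
    exact h
  funext n
  have h1 := ascPochhammer_pos n r hr
  rw [beta_add_natCast hr hb, hgCoeff, hgCoeff]
  field_simp

/-- Raising `b` by one raises the lower parameter `r + b` of the series by one, so the contiguous
relation applies; the convergence it needs comes from integrability. -/
lemma integral_bhNum_add_one {b p q r : ℝ} (hr : 0 < r) (hb : 0 < b)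
    (hint : IntegrableOn (bhNum r b p q r) (Ioo 0 1)) :
    (r + b - p) * (r + b - q) * ∫ x in Ioo 0 1, bhNum r (b + 1) p q r x =
      b * (r + b - p - q) * ∫ x in Ioo 0 1, bhNum r b p q r x := by
  have hint' := integrableOn_bhNum_add_natCast hint 1
  rw [Nat.cast_one] at hint'
  have h1 := hasSum_hgCoeff_integral_bhNum hr hb hint
  have h2 := hasSum_hgCoeff_integral_bhNum hr (by positivity) hint'
  have hB1 := beta_pos hr hb
  have hB2 := beta_pos hr (show 0 < b + 1 by positivity)
  have hγ : 0 < r + b := by positivity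
  rw [← add_assoc] at h2
  have h3 := tsum_hgCoeff_add_one (p := p) (q := q) hγ
    ((summable_mul_left_iff hB1.ne').1 h1.summable)
    ((summable_mul_left_iff hB2.ne').1 h2.summable)
  rw [← h1.tsum_eq, ← h2.tsum_eq, tsum_mul_left, tsum_mul_left]
  have hB : ProbabilityTheory.beta r (b + 1) * (r + b) = b * ProbabilityTheory.beta r b := by
    have := Real.Gamma_pos_of_pos hγ
    rw [beta, beta, ← add_assoc, Real.Gamma_add_one hb.ne', Real.Gamma_add_one hγ.ne']
    field_simp
  apply mul_right_cancel₀ hγ.ne'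
  linear_combination b * ProbabilityTheory.beta r b * h3 +
    ((r + b - p) * (r + b - q) * ∑' n, hgCoeff p q (r + b + 1) n) * hB

/-- These are the moments of `1 - x`, in multiplied-out form because the Pochhammer factors on the
left may vanish here. -/
lemma integral_bhNum_add_natCast {b p q r : ℝ} (hr : 0 < r) (hb : 0 < b)
    (hint : IntegrableOn (bhNum r b p q r) (Ioo 0 1)) (n : ℕ) :
    (ascPochhammer ℝ n).eval (r + b - p) * (ascPochhammer ℝ n).eval (r + b - q) *
        ∫ x in Ioo 0 1, bhNum r (b + n) p q r x =
      (ascPochhammer ℝ n).eval b * (ascPochhammer ℝ n).eval (r + b - p - q) *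
        ∫ x in Ioo 0 1, bhNum r b p q r x := by
  induction n with
  | zero => simp
  | succ n ih =>
    have h := integral_bhNum_add_one (b := b + n) hr (by positivity)
      (integrableOn_bhNum_add_natCast hint n)
    simp only [ascPochhammer_succ_eval, Nat.cast_succ, ← add_assoc] at h ⊢
    linear_combination (ascPochhammer ℝ n).eval (r + b - p) *
      (ascPochhammer ℝ n).eval (r + b - q) * h + (b + n) * (r + b - p - q + n) * ih

/-! ### The integral transform behind one step -/

/-- The Euler-type integral representation that transforms one beta hypergeometric density into
another. -/
lemma lintegral_bhNum_mul_rpow {b p q r : ℝ} (hr : 0 < r) (hb : 0 < b) (hq : 0 < r + b - q)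
    (hp : ∀ n : ℕ, r + b - p ≠ -(n : ℝ)) (hpos : ∀ x ∈ Ioo (0 : ℝ) 1, 0 < ₂F₁ p q r x)
    (hint : IntegrableOn (bhNum r b p q r) (Ioo 0 1)) {y : ℝ} (hy : y ∈ Ioo (0 : ℝ) 1) :
    ∫⁻ x in Ioo 0 1,
        ENNReal.ofReal (bhNum r b p q r x * (1 - y * (1 - x)) ^ (-(r + b - q))) =
      ENNReal.ofReal ((∫ x in Ioo 0 1, bhNum r b p q r x) *
        ₂F₁ b (r + b - p - q) (r + b - p) y) := by
  have hy0 := hy.1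
  have hnum : ∀ (n : ℕ), ∀ x ∈ Ioo (0 : ℝ) 1, 0 < bhNum r (b + n) p q r x := fun n x hx => by
    have h1 : 0 < 1 - x := by linarith [hx.2]
    have h2 := hx.1
    have h3 := hpos x hx
    unfold bhNum
    positivity
  have hc : ∀ n, 0 ≤ hgCoeff (r + b - q) 1 1 n := fun n => by
    have := ascPochhammer_pos n (r + b - q) hq
    have := ascPochhammer_pos n (1 : ℝ) one_pos
    unfold hgCoeff
    positivity
  -- Terms of the binomial series in `y * (1 - x)`, with `(1 - x) ^ n` absorbed into `b + n`.
  set f : ℕ → ℝ → ℝ := fun n x => hgCoeff (r + b - q) 1 1 n * y ^ n * bhNum r (b + n) p q r x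
    with hf
  have hf0 : ∀ n, ∀ x ∈ Ioo (0 : ℝ) 1, 0 ≤ f n x := fun n x hx => by
    have := hc n
    have := hnum n x hx
    simp only [hf]
    positivity
  have hsum : ∀ x ∈ Ioo (0 : ℝ) 1,
      HasSum (fun n => f n x) (bhNum r b p q r x * (1 - y * (1 - x)) ^ (-(r + b - q))) := by
    intro x hx
    have h1 : 0 < 1 - x := by linarith [hx.2]
    have h := (hasSum_one_sub_rpow_neg (r + b - q) (x := y * (1 - x)) (by
      rw [abs_of_pos (by positivity)]
      nlinarith [hx.1, hy.2])).mul_left (bhNum r b p q r x)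
    have heq : (fun n => f n x) = fun n =>
        bhNum r b p q r x * (hgCoeff (r + b - q) 1 1 n * (y * (1 - x)) ^ n) := by
      funext n
      simp only [hf]
      rw [bhNum_add_natCast r b p q r n hx, mul_pow]
      ring
    rw [heq]
    exact h
  have hfint : ∀ n, IntegrableOn (f n) (Ioo 0 1) := fun n =>
    (integrableOn_bhNum_add_natCast hint n).const_mul _
  -- The binomial factor `(r + b - q)ₙ` cancels the same factor in the moment formula; the other
  -- quotients form the new `₂F₁`.
  have hterm : ∀ n, ∫ x in Ioo 0 1, f n x = (∫ x in Ioo 0 1, bhNum r b p q r x) *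
      (hgCoeff b (r + b - p - q) (r + b - p) n * y ^ n) := by
    intro n
    have h1 := integral_bhNum_add_natCast hr hb hint n
    have h2 := ascPochhammer_pos n (r + b - q) hq
    have h3 := ascPochhammer_eval_ne_zero hp n
    have h4 := ascPochhammer_pos n (1 : ℝ) one_pos
    simp only [hf, integral_const_mul, hgCoeff]
    field_simp
    linear_combination h1
  have hS := (hasSum_ordinaryHypergeometric hp b (r + b - p - q)
    (by rw [abs_of_pos hy0]; exact hy.2)).mul_left (∫ x in Ioo 0 1, bhNum r b p q r x)
  simp only [← hterm] at hS
  -- The terms of the resulting series are nonnegative as integrals of nonnegative functions, so no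
  -- sign analysis of its coefficients is needed.
  have hI0 : ∀ n, 0 ≤ ∫ x in Ioo 0 1, f n x := fun n =>
    setIntegral_nonneg measurableSet_Ioo (hf0 n)
  rw [← hS.tsum_eq, ENNReal.ofReal_tsum_of_nonneg hI0 hS.summable]
  calc _ = ∫⁻ x in Ioo 0 1, ∑' n, ENNReal.ofReal (f n x) := by
        refine setLIntegral_congr_fun measurableSet_Ioo fun x hx => ?_
        rw [← (hsum x hx).tsum_eq,
          ENNReal.ofReal_tsum_of_nonneg (fun n => hf0 n x hx) (hsum x hx).summable]
    _ = ∑' n, ∫⁻ x in Ioo 0 1, ENNReal.ofReal (f n x) :=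
        lintegral_tsum fun n => (hfint n).aestronglyMeasurable.aemeasurable.ennreal_ofReal
    _ = _ := tsum_congr fun n => (ofReal_integral_eq_lintegral_ofReal (hfint n)
        (ae_restrict_of_forall_mem measurableSet_Ioo (hf0 n))).symm

/-! ### The random Moebius transformation -/

instance (κ a b p q r : ℝ) : SFinite (scaledBH κ a b p q r) := by
  unfold scaledBH
  infer_instance

instance (c d : ℝ) : SFinite (betaSecondKind c d) := by
  unfold betaSecondKind
  infer_instance

lemma measurable_moebius : Measurable fun z : ℝ × ℝ => moebius z.2 z.1 := by
  unfold moebius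
  fun_prop

lemma image_moebius_Ioi {x : ℝ} (hx : 0 < x) : (fun w => moebius w x) '' Ioi 0 = Ioo 0 1 := by
  ext y
  simp only [mem_image, mem_Ioi, mem_Ioo, moebius]
  constructor
  · rintro ⟨w, hw, rfl⟩
    refine ⟨by positivity, ?_⟩
    rw [div_lt_one (by positivity)]
    linarith [mul_pos hw hx]
  · rintro ⟨hy0, hy1⟩
    refine ⟨(1 - y) / (x * y), div_pos (by linarith) (by positivity), ?_⟩
    field_simp
    ring

/-- The image of the beta distribution of the second kind under `w ↦ 1 / (1 + w x)`. -/
lemma lintegral_betaSecondKind_moebius (c d : ℝ) {x : ℝ} (hx : x ∈ Ioo (0 : ℝ) 1)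
    {φ : ℝ → ENNReal} (hφ : Measurable φ) :
    ∫⁻ w, φ (moebius w x) ∂(betaSecondKind c d) =
      ∫⁻ y in Ioo 0 1, ENNReal.ofReal (1 / ProbabilityTheory.beta c d * (x ^ d * (1 - y) ^ (c - 1) *
        y ^ (d - 1) * (1 - y * (1 - x)) ^ (-(c + d)))) * φ y := by
  have hx0 := hx.1
  have hφ' : Measurable fun w => φ (moebius w x) :=
    hφ.comp (measurable_moebius.comp (measurable_const.prodMk measurable_id))
  rw [betaSecondKind, lintegral_withDensity_eq_lintegral_mul _ (by fun_prop) hφ',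
    ← image_moebius_Ioi hx0, lintegral_image_eq_lintegral_abs_deriv_mul
      (f' := fun w => -x / (1 + w * x) ^ 2) measurableSet_Ioi]
  · refine setLIntegral_congr_fun measurableSet_Ioi fun w hw => ?_
    have hw0 : 0 < w := hw
    have h1 : 0 < 1 + w * x := by positivity
    have h2 : 0 < 1 + w := by positivity
    have hy : 1 - moebius w x = w * x / (1 + w * x) := by
      rw [moebius]
      field_simp
      ring
    have hz : 1 - moebius w x * (1 - x) = x * (1 + w) / (1 + w * x) := by
      rw [moebius]
      field_simp
      ring
    simp only [Pi.mul_apply]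
    rw [← mul_assoc, ← ENNReal.ofReal_mul (abs_nonneg _)]
    congr 2
    rw [hy, hz, moebius, abs_div, abs_neg, abs_of_pos hx0,
      abs_of_pos (by positivity : 0 < (1 + w * x) ^ 2), mul_left_comm]
    congr 1
    -- All powers are reduced to the exponents `c - 1`, `d - 1` and `c + d`, after which the
    -- identity is rational in them.
    have e1 : x ^ d = x ^ (c + d) * (x ^ (c - 1))⁻¹ * x⁻¹ := by
      rw [← Real.rpow_neg hx0.le, ← Real.rpow_add hx0, ← Real.rpow_neg_one x, ← Real.rpow_add hx0]
      congr 1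
      ring
    have e2 : (1 + w * x) ^ (d - 1) * (1 + w * x) ^ (c - 1) * (1 + w * x) ^ 2 =
        (1 + w * x) ^ (c + d) := by
      rw [← Real.rpow_add h1, ← Real.rpow_natCast, ← Real.rpow_add h1]
      congr 1
      push_cast
      ring
    rw [Real.div_rpow (by positivity) h1.le, Real.div_rpow one_pos.le h1.le,
      Real.div_rpow (by positivity) h1.le, Real.mul_rpow hw0.le hx0.le, Real.mul_rpow hx0.le h2.le,
      Real.rpow_neg hx0.le, Real.rpow_neg h2.le, Real.rpow_neg h1.le, Real.one_rpow, e1, ← e2]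
    have p1 := Real.rpow_pos_of_pos h1 (d - 1)
    have p2 := Real.rpow_pos_of_pos h1 (c - 1)
    have p3 := Real.rpow_pos_of_pos hx0 (c - 1)
    have p4 := Real.rpow_pos_of_pos hx0 (c + d)
    have p5 := Real.rpow_pos_of_pos h2 (c + d)
    field_simp
  · intro w hw
    have hw0 : 0 < w := hw
    have h1 : 1 + w * x ≠ 0 := by positivity
    have h := (((hasDerivAt_id w).mul_const x).const_add 1).inv h1
    simp only [one_mul, id_eq] at h
    exact (h.congr_of_eventuallyEq (by
      filter_upwards with u
      simp [moebius])).hasDerivWithinAt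
  · intro w hw w' hw' heq
    simp only [moebius, one_div] at heq
    exact mul_right_cancel₀ hx0.ne' (add_left_cancel (inv_injective heq))

/-- The effect of a random Moebius transformation on a beta hypergeometric density. -/
lemma map_moebius_scaledBH {κ a b p q r c d : ℝ} (hκ : 0 ≤ κ) (ha : 0 < a) (hb : 0 < b)
    (hc : 0 < c) (hd : 0 < d) (hr : r = a + d) (hcd : c + d = r + b - q)
    (hp : ∀ n : ℕ, r + b - p ≠ -(n : ℝ)) (hpos : ∀ x ∈ Ioo (0 : ℝ) 1, 0 < ₂F₁ p q r x)
    (hint : IntegrableOn (bhNum a b p q r) (Ioo 0 1)) :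
    ((scaledBH κ a b p q r).prod (betaSecondKind c d)).map (fun z => moebius z.2 z.1) =
      scaledBH (κ * (1 / ProbabilityTheory.beta c d) * ∫ x in Ioo 0 1, bhNum r b p q r x)
        d c b (r + b - p - q) (r + b - p) := by
  have hr0 : 0 < r := by linarith
  have hrp := ne_neg_natCast_of_pos hr0
  -- The kernel supplies `x ^ d`, which changes `a` into `a + d = r`.
  have hint' : IntegrableOn (bhNum r b p q r) (Ioo 0 1) :=
    integrableOn_bhNum_of_le (by linarith) hrp hint
  have hB := beta_pos hc hd
  have hmeas : AEMeasurable (fun x => ENNReal.ofReal (κ * bhNum a b p q r x))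
      (volume.restrict (Ioo 0 1)) :=
    ((aestronglyMeasurable_bhNum hrp a b p q).aemeasurable.const_mul κ).ennreal_ofReal
  ext s hs
  set φ : ℝ → ENNReal := s.indicator 1
  have hφ : Measurable φ := measurable_one.indicator hs
  set k : ℝ → ℝ → ENNReal := fun x y => ENNReal.ofReal (1 / ProbabilityTheory.beta c d *
    (x ^ d * (1 - y) ^ (c - 1) * y ^ (d - 1) * (1 - y * (1 - x)) ^ (-(c + d)))) with hk
  have hkm : Measurable (Function.uncurry k) := by
    simp only [hk, Function.uncurry_def]
    fun_prop
  calc ((scaledBH κ a b p q r).prod (betaSecondKind c d)).map (fun z => moebius z.2 z.1) s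
      = ∫⁻ y, φ y ∂(((scaledBH κ a b p q r).prod (betaSecondKind c d)).map
          (fun z => moebius z.2 z.1)) := (lintegral_indicator_one hs).symm
    _ = ∫⁻ x, ∫⁻ w, φ (moebius w x) ∂(betaSecondKind c d) ∂(scaledBH κ a b p q r) := by
        rw [lintegral_map hφ measurable_moebius]
        exact lintegral_prod _ (hφ.comp measurable_moebius).aemeasurable
    _ = ∫⁻ x in Ioo 0 1, ENNReal.ofReal (κ * bhNum a b p q r x) *
          ∫⁻ w, φ (moebius w x) ∂(betaSecondKind c d) := by
        rw [scaledBH, lintegral_withDensity_eq_lintegral_mul₀ hmeas]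
        · rfl
        · exact (Measurable.lintegral_prod_right'
            (f := fun z : ℝ × ℝ => φ (moebius z.2 z.1)) (hφ.comp measurable_moebius)).aemeasurable
    _ = ∫⁻ x in Ioo 0 1, ∫⁻ y in Ioo 0 1,
          ENNReal.ofReal (κ * bhNum a b p q r x) * (k x y * φ y) := by
        refine setLIntegral_congr_fun measurableSet_Ioo fun x hx => ?_
        rw [lintegral_betaSecondKind_moebius c d hx hφ, lintegral_const_mul]
        exact (hkm.comp (measurable_const.prodMk measurable_id)).mul hφ
    _ = ∫⁻ y in Ioo 0 1, ∫⁻ x in Ioo 0 1,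
          ENNReal.ofReal (κ * bhNum a b p q r x) * (k x y * φ y) := by
        refine lintegral_lintegral_swap ?_
        exact hmeas.comp_fst.mul (hkm.mul (hφ.comp measurable_snd)).aemeasurable
    _ = ∫⁻ y in Ioo 0 1, ENNReal.ofReal (κ * (1 / ProbabilityTheory.beta c d) *
          (∫ x in Ioo 0 1, bhNum r b p q r x) *
          bhNum d c b (r + b - p - q) (r + b - p) y) * φ y := by
        refine setLIntegral_congr_fun measurableSet_Ioo fun y hy => ?_
        have hy0 := hy.1
        have hy1 : 0 < 1 - y := by linarith [hy.2]
        have hcoef : 0 ≤ κ * (1 / ProbabilityTheory.beta c d) *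
            (y ^ (d - 1) * (1 - y) ^ (c - 1)) := by positivity
        have h1 : ∀ x ∈ Ioo (0 : ℝ) 1, ENNReal.ofReal (κ * bhNum a b p q r x) * (k x y * φ y) =
            φ y * ENNReal.ofReal
              (κ * (1 / ProbabilityTheory.beta c d) * (y ^ (d - 1) * (1 - y) ^ (c - 1))) *
              ENNReal.ofReal (bhNum r b p q r x * (1 - y * (1 - x)) ^ (-(r + b - q))) := by
          intro x hx
          have hx0 := hx.1
          have hx1 : 0 < 1 - x := by linarith [hx.2]
          have hF := hpos x hx
          have h2 : 0 ≤ κ * bhNum a b p q r x := by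
            unfold bhNum
            positivity
          have h3 : bhNum r b p q r x = x ^ d * bhNum a b p q r x := by
            rw [bhNum, bhNum, hr, show a + d - 1 = d + (a - 1) by ring, Real.rpow_add hx0]
            ring
          rw [← mul_assoc, mul_comm _ (φ y), mul_assoc, ← ENNReal.ofReal_mul h2,
            ← ENNReal.ofReal_mul hcoef, h3, hcd]
          congr 2
          ring
        rw [setLIntegral_congr_fun measurableSet_Ioo h1, lintegral_const_mul'',
          lintegral_bhNum_mul_rpow hr0 hb (by linarith) hp hpos hint' hy, mul_assoc,
          ← ENNReal.ofReal_mul hcoef, mul_comm]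
        · congr 2
          rw [bhNum]
          ring
        · refine AEMeasurable.ennreal_ofReal (AEMeasurable.mul
            (aestronglyMeasurable_bhNum hrp r b p q).aemeasurable ?_)
          exact Measurable.aemeasurable (by fun_prop)
    _ = _ := by
        rw [scaledBH, withDensity_apply _ hs, ← lintegral_indicator hs]
        refine lintegral_congr fun y => ?_
        by_cases hy : y ∈ s <;> simp [φ, hy]

/-! ### Representatives of vertices and a single edge -/

/-- Swapping the last two entries exchanges `p` and `q`; swapping the middle two is Euler's
transformation followed by that exchange. -/
lemma bhThetaExists_and_bhNum_eq_of_triple_eq {t t' : Fin 5 → ℝ} (heq : triple t = triple t')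
    (h : BHThetaExists t) : BHThetaExists t' ∧ ∀ x ∈ Ioo (0 : ℝ) 1,
      bhNum (t 3 + t 4) (t 0 + t 2) (t 2 + t 4) (t 2 + t 3) (t 1 + t 2 + t 3 + t 4) x =
      bhNum (t' 3 + t' 4) (t' 0 + t' 2) (t' 2 + t' 4) (t' 2 + t' 3)
        (t' 1 + t' 2 + t' 3 + t' 4) x := by
  have key : ∀ u0 u1 u2 u3 u4 : ℝ,
      BHParam (u3 + u4) (u0 + u2) (u2 + u4) (u2 + u3) (u1 + u2 + u3 + u4) →
      BHParam (u3 + u4) (u0 + u1) (u1 + u4) (u1 + u3) (u2 + u1 + u3 + u4) ∧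
      ∀ x ∈ Ioo (0 : ℝ) 1,
        bhNum (u3 + u4) (u0 + u2) (u2 + u4) (u2 + u3) (u1 + u2 + u3 + u4) x =
        bhNum (u3 + u4) (u0 + u1) (u1 + u4) (u1 + u3) (u2 + u1 + u3 + u4) x := by
    intro u0 u1 u2 u3 u4 hu
    have e1 : u0 + u1 = (u1 + u2 + u3 + u4) + (u0 + u2) - (u2 + u3) - (u2 + u4) := by ring
    have e2 : u1 + u4 = (u1 + u2 + u3 + u4) - (u2 + u3) := by ring
    have e3 : u1 + u3 = (u1 + u2 + u3 + u4) - (u2 + u4) := by ring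
    have e4 : u2 + u1 + u3 + u4 = u1 + u2 + u3 + u4 := by ring
    rw [e1, e2, e3, e4]
    exact ⟨hu.comm.euler, fun x hx => by rw [bhNum_comm, bhNum_euler hu.not_pole hx]⟩
  have swap : ∀ u0 u1 u2 u3 u4 : ℝ,
      BHParam (u3 + u4) (u0 + u2) (u2 + u4) (u2 + u3) (u1 + u2 + u3 + u4) →
      BHParam (u4 + u3) (u0 + u2) (u2 + u3) (u2 + u4) (u1 + u2 + u4 + u3) ∧
      ∀ x ∈ Ioo (0 : ℝ) 1,
        bhNum (u3 + u4) (u0 + u2) (u2 + u4) (u2 + u3) (u1 + u2 + u3 + u4) x =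
        bhNum (u4 + u3) (u0 + u2) (u2 + u3) (u2 + u4) (u1 + u2 + u4 + u3) x := by
    intro u0 u1 u2 u3 u4 hu
    rw [add_comm u4 u3, add_right_comm _ u4 u3]
    exact ⟨hu.comm, fun x _ => bhNum_comm _ _ _ _ _ _⟩
  simp only [triple, Prod.mk.injEq, Sym2.eq_iff] at heq
  obtain ⟨h0, h12, h34⟩ := heq
  unfold BHThetaExists at h ⊢
  rcases h12 with ⟨h1, h2⟩ | ⟨h1, h2⟩ <;> rcases h34 with ⟨h3, h4⟩ | ⟨h3, h4⟩ <;>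
    rw [h0, h1, h2, h3, h4] at h ⊢
  · exact ⟨h, fun x _ => rfl⟩
  · exact swap _ _ _ _ _ h
  · exact key _ _ _ _ _ h
  · obtain ⟨h5, h6⟩ := key _ _ _ _ _ h
    obtain ⟨h7, h8⟩ := swap _ _ _ _ _ h5
    exact ⟨h7, fun x hx => (h6 x hx).trans (h8 x hx)⟩

lemma BHThetaExists.of_triple_eq {t t' : Fin 5 → ℝ} (h : BHThetaExists t)
    (heq : triple t = triple t') : BHThetaExists t' :=
  (bhThetaExists_and_bhNum_eq_of_triple_eq heq h).1

lemma bhTheta_eq_of_triple_eq {t t' : Fin 5 → ℝ} (h : BHThetaExists t)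
    (heq : triple t = triple t') [hP : IsProbabilityMeasure (bhTheta t)] :
    bhTheta t = bhTheta t' := by
  obtain ⟨h', hnum⟩ := bhThetaExists_and_bhNum_eq_of_triple_eq heq h
  unfold bhTheta at hP ⊢
  exact bh_eq_of_bhNum_eq h' hnum

/-- The two kinds of edges differ by the labelling of the pair `{t₄, t₅}`, so one kind suffices. The
order of entries at the end vertex matches the output parameters of `map_moebius_scaledBH`. -/
lemma exists_triple_of_adj {θ : Fin 5 → ℝ} {v v' : Vertex θ} (h : (graph θ).Adj v v') :
    ∃ t : Fin 5 → ℝ, v.1 = triple t ∧ v'.1 = triple ![t 4, t 3, t 0, t 1, t 2] := by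
  obtain ⟨t, ht, h | h⟩ := h
  · refine ⟨t, ht, ?_⟩
    rw [h, Sym2.eq_swap (a := t 0)]
    rfl
  · refine ⟨![t 0, t 1, t 2, t 4, t 3], ?_, ?_⟩
    · rw [ht, triple, Sym2.eq_swap (a := t 3)]
      rfl
    · rw [h, Sym2.eq_swap (a := t 0)]
      rfl

lemma isProbabilityMeasure_of_hasLaw {Ω : Type*} [MeasurableSpace Ω] {μ : Measure Ω}
    [IsProbabilityMeasure μ] {X : Ω → ℝ} {P : Measure ℝ} (hX : HasLaw X P μ) :
    IsProbabilityMeasure P := by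
  rw [← hX.map_eq]
  exact Measure.isProbabilityMeasure_map hX.aemeasurable

/-- One step of the continued fraction, for the representative `(t₅, t₄, t₁, t₂, t₃)` of the end of
an edge. -/
lemma hasLaw_moebius {Ω : Type*} [MeasurableSpace Ω] {μ : Measure Ω}
    [IsProbabilityMeasure μ] {t : Fin 5 → ℝ} (h : BHThetaExists t)
    (h' : BHThetaExists ![t 4, t 3, t 0, t 1, t 2]) (hc : 0 < t 0 + t 4) (hd : 0 < t 1 + t 2)
    {X W : Ω → ℝ} (hX : HasLaw X (bhTheta t) μ)
    (hW : HasLaw W (betaSecondKind (t 0 + t 4) (t 1 + t 2)) μ) (hXW : X ⟂ᵢ[μ] W) :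
    HasLaw (fun ω => moebius (W ω) (X ω)) (bhTheta ![t 4, t 3, t 0, t 1, t 2]) μ := by
  have hmeas : AEMeasurable (fun ω => (X ω, W ω)) μ := hX.aemeasurable.prodMk hW.aemeasurable
  have hYm : AEMeasurable (fun ω => moebius (W ω) (X ω)) μ :=
    measurable_moebius.comp_aemeasurable hmeas
  refine ⟨hYm, ?_⟩
  have hmap : μ.map (fun ω => moebius (W ω) (X ω)) =
      ((bhTheta t).prod (betaSecondKind (t 0 + t 4) (t 1 + t 2))).map
        (fun z => moebius z.2 z.1) := by
    rw [← hX.map_eq, ← hW.map_eq,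
      ← (indepFun_iff_map_prod_eq_prod_map_map hX.aemeasurable hW.aemeasurable).1 hXW,
      AEMeasurable.map_map_of_aemeasurable measurable_moebius.aemeasurable hmeas]
    rfl
  have hP := isProbabilityMeasure_of_hasLaw hX
  have hQ : IsProbabilityMeasure (μ.map fun ω => moebius (W ω) (X ω)) :=
    Measure.isProbabilityMeasure_map hYm
  unfold BHThetaExists at h h'
  unfold bhTheta at hP hmap ⊢
  simp only [Matrix.cons_val] at h' ⊢
  rw [bh_eq_scaledBH] at hP hmap
  obtain ⟨hκ, hint, -⟩ := of_isProbabilityMeasure_scaledBH (hP := hP) h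
  have e1 : t 1 + t 2 + t 3 + t 4 + (t 0 + t 2) - (t 2 + t 4) - (t 2 + t 3) = t 0 + t 1 := by ring
  have e2 : t 1 + t 2 + t 3 + t 4 + (t 0 + t 2) - (t 2 + t 4) = t 3 + t 0 + t 1 + t 2 := by ring
  -- The lower parameter `r + b - p` is the `r` of the end vertex, so the existence of its
  -- distribution excludes poles.
  rw [map_moebius_scaledBH hκ.le h.a_pos h.b_pos hc hd (by ring) (by ring)
    (by rw [e2]; exact h'.not_pole) h.hypergeometric_pos hint, e1, e2, add_comm (t 0) (t 4)] at hmap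
  rw [hmap] at hQ ⊢
  exact scaledBH_eq_bh h'

/-! ### Continued fractions and independence -/

lemma measurable_contFrac (n : ℕ) :
    Measurable fun z : (Fin n → ℝ) × ℝ => contFrac n z.1 z.2 := by
  induction n with
  | zero => exact measurable_snd
  | succ n ih =>
    have h1 : Measurable fun z : (Fin (n + 1) → ℝ) × ℝ =>
        ((fun i => z.1 (Fin.castSucc i)), z.2) := by
      fun_prop
    have h2 : Measurable fun z : (Fin (n + 1) → ℝ) × ℝ => z.1 (Fin.last n) := by fun_prop
    exact measurable_moebius.comp ((ih.comp h1).prodMk h2)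

lemma indepFun_contFrac_last {Ω : Type*} [MeasurableSpace Ω] {μ : Measure Ω}
    {n : ℕ} {X₀ : Ω → ℝ} {W : Fin (n + 1) → Ω → ℝ}
    (hindep : iIndepFun (Fin.cons X₀ W : Fin (n + 2) → Ω → ℝ) μ) (hX₀ : AEMeasurable X₀ μ)
    (hW : ∀ j, AEMeasurable (W j) μ) :
    (fun ω => contFrac n (fun j => W j.castSucc ω) (X₀ ω)) ⟂ᵢ[μ] W (Fin.last n) := by
  set f : Fin (n + 2) → Ω → ℝ := Fin.cons X₀ W with hf
  have hfm : ∀ i, AEMeasurable (f i) μ := fun i => by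
    cases i using Fin.cases with
    | zero => exact hX₀
    | succ j => exact hW j
  have h := hindep.indepFun_finset₀ {Fin.last (n + 1)}ᶜ {Fin.last (n + 1)}
    disjoint_compl_left hfm
  have hmem : ∀ i : Fin (n + 1), i.castSucc ∈ ({Fin.last (n + 1)}ᶜ : Finset (Fin (n + 2))) :=
    fun i => by simp
  have hmem' : Fin.last (n + 1) ∈ ({Fin.last (n + 1)} : Finset (Fin (n + 2))) := by simp
  -- Index 0 of the family carries `X₀`, so `W j.castSucc` sits at `j.succ.castSucc`, and the last
  -- `W` at `Fin.last (n + 1)`.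
  have h1 : Measurable fun (z : ({Fin.last (n + 1)}ᶜ : Finset (Fin (n + 2))) → ℝ) (j : Fin n) =>
      z ⟨j.succ.castSucc, hmem j.succ⟩ := measurable_pi_lambda _ fun j => measurable_pi_apply _
  have h2 : Measurable fun z : ({Fin.last (n + 1)}ᶜ : Finset (Fin (n + 2))) → ℝ =>
      z ⟨Fin.castSucc 0, hmem 0⟩ := measurable_pi_apply _
  have hφ := (measurable_contFrac n).comp (h1.prodMk h2)
  have hψ : Measurable fun z : ({Fin.last (n + 1)} : Finset (Fin (n + 2))) → ℝ =>
      z ⟨Fin.last (n + 1), hmem'⟩ := measurable_pi_apply _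
  exact h.comp hφ hψ

end BetaHypergeometric

open BetaHypergeometric
theorem proposition4p1 (θ : Fin 5 → ℝ) (n : ℕ)
    -- a path `v₀ → v₁ → ⋯ → vₙ` in `G**_θ`
    (v : Fin (n + 1) → VertexStarStar θ)
    (hv : ∀ j : Fin n, (graphStarStar θ).Adj (v j.castSucc) (v j.succ))
    -- independent random variables `X₀, W₁, …, Wₙ` (`W j` stands for `W_{j+1}`)
    {Ω : Type*} [MeasurableSpace Ω] (μ : Measure Ω) [IsProbabilityMeasure μ]
    (X₀ : Ω → ℝ) (W : Fin n → Ω → ℝ)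
    (hindep : iIndepFun (Fin.cons X₀ W : Fin (n + 1) → Ω → ℝ) μ)
    -- `X₀ ∼ BH_{v₀}`, where `t` is any representative of `v₀`
    (t : Fin 5 → ℝ) (ht : triple t = (v 0).1.1) (hX₀ : HasLaw X₀ (bhTheta t) μ)
    (hW : ∀ j : Fin n, HasLaw (W j) (edgeLaw (v j.castSucc).1.1 (v j.succ).1.1) μ)
    -- `t'` is any representative of `vₙ`
    (t' : Fin 5 → ℝ) (ht' : triple t' = (v (Fin.last n)).1.1) :
    HasLaw (fun ω => contFrac n (fun j => W j ω) (X₀ ω)) (bhTheta t') μ := by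
  induction n generalizing t' with
  | zero =>
    obtain ⟨u, hu, hex⟩ := (v 0).2
    have hP := isProbabilityMeasure_of_hasLaw hX₀
    -- `t` and `t'` may be different representatives of the same vertex.
    have heq : bhTheta t = bhTheta t' :=
      bhTheta_eq_of_triple_eq (hex.of_triple_eq (hu.symm.trans ht.symm)) (ht.trans ht'.symm)
    rw [← heq]
    exact hX₀
  | succ n ih =>
    obtain ⟨hadj, hd, hc⟩ := hv (Fin.last n)
    obtain ⟨u, hu, hu'⟩ := exists_triple_of_adj hadj
    rw [Fin.succ_last] at hu' hd hc
    have hexu : BHThetaExists u := by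
      obtain ⟨s, hs, hex⟩ := (v (Fin.last n).castSucc).2
      exact hex.of_triple_eq (hs.symm.trans hu)
    have hexu' : BHThetaExists ![u 4, u 3, u 0, u 1, u 2] := by
      obtain ⟨s, hs, hex⟩ := (v (Fin.last (n + 1))).2
      exact hex.of_triple_eq (hs.symm.trans hu')
    have hWn := hW (Fin.last n)
    rw [Fin.succ_last, edgeLaw] at hWn
    rw [hu, hu'] at hc hd hWn
    change HasLaw (W (Fin.last n)) (betaSecondKind (u 0 + u 4) (u 1 + u 2)) μ at hWn
    change 0 < u 0 + u 4 at hc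
    change 0 < u 1 + u 2 at hd
    -- The induction hypothesis is used at the representative `u` adapted to the last edge, which is
    -- why `t'` is generalized.
    have hY := ih (fun i => v i.castSucc) (fun j => hv j.castSucc) (fun j => W j.castSucc)
      (by
        have := hindep.precomp (Fin.castSucc_injective (n + 1))
        convert this using 1
        funext i
        cases i using Fin.cases <;> rfl)
      ht (fun j => hW j.castSucc) u hu.symm
    have hind : (fun ω => contFrac n (fun j => W j.castSucc ω) (X₀ ω)) ⟂ᵢ[μ] W (Fin.last n) :=
      indepFun_contFrac_last hindep hX₀.aemeasurable fun j => (hW j).aemeasurable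
    have hlaw := hasLaw_moebius hexu hexu' hc hd hY hWn hind
    have hP := isProbabilityMeasure_of_hasLaw hlaw
    rw [bhTheta_eq_of_triple_eq hexu' (hu'.symm.trans ht'.symm)] at hlaw
    exact hlaw
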